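/- Fix $K\ge 1$, path loss factors $\alpha_1,\dots,\alpha_K\ge 0$ and power budgets $\rho_0,\dots,\rho_{K-1}>0$. For every $n\ge 1$ let $n_0=n$ and let $n_k=n_k(n)$, $k=1,\dots,K$, be positive integers such that $c_k=n_{k-1}/n_k$ satisfies $0<\liminf_{n\to\infty} c_k\le\limsup_{n\to\infty} c_k<\infty$ for $k=1,\dots,K$. For every $n$, let $\mathbf H_k\in\mathbb C^{n_k\times n_{k-1}}$ ($k=1,\dots,K$) be random matrices with i.i.d. $\mathcal{CN}(0,1)$ entries, let $\mathbf x\sim\mathcal{CN}(\mathbf 0,\mathbf I_n)$ and $\mathbf n_k\sim\mathcal{CN}(\mathbf 0,\mathbf I_{n_k})$ ($k=1,\dots,K$), with $\mathbf H_1,\dots,\mathbf H_K,\mathbf x,\mathbf n_1,\dots,\mathbf n_K$ mutually independent; all are defined on one probability space, and nothing is assumed about the joint law for different $n$. Define recursively $\mathbf y_0=\mathbf x$ and $$\mathbf y_k=\sqrt{\alpha_k}\,\mathbf H_k\sqrt{\frac{\beta_{k-1}}{n_{k-1}}}\,\mathbf y_{k-1}+\mathbf n_k\quad(k=1,\dots,K),\qquad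 \beta_k=\frac{\rho_k}{\frac1{n_k}\operatorname{tr}\mathbb E\left[\mathbf y_k\mathbf y_k^{\mathsf H}\right]}\quad(k=0,\dots,K-1),$$ where the expectation is with respect to $\mathbf x$ and the noise vectors $\mathbf n_1,\dots,\mathbf n_K$ only, the matrices $\mathbf H_1,\dots,\mathbf H_K$ being held fixed, so that $\beta_k$ is a random variable depending on $\mathbf H_1,\dots,\mathbf H_k$. Then $\beta_0=\rho_0$ for every $n\ge1$, and for every $k=1,\dots,K-1$, almost surely, $$\beta_k\xrightarrow[n\to\infty]{}\bar\beta_k=\frac{\rho_k}{1+\alpha_k\rho_{k-1}}.$$ -/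

import Mathlib

open MeasureTheory ProbabilityTheory Filter Topology
open scoped ENNReal NNReal

noncomputable section

namespace Relay

/-- The standard circularly symmetric complex Gaussian law `CN(0,1)`: independent real and imaginary
parts, each centred Gaussian with variance `1/2`. -/
def stdComplexGaussian : Measure ℂ :=
  ((gaussianReal 0 (1 / 2)).prod (gaussianReal 0 (1 / 2))).map Complex.measurableEquivRealProd.symm

variable {Ω : Type*} [MeasurableSpace Ω]

/-- The matrix `E[y yᴴ]` of a random vector `y`. -/
def secondMoment (P : Measure Ω) {m : ℕ} (y : Ω → Fin m → ℂ) : Matrix (Fin m) (Fin m) ℂ :=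
  Matrix.of fun i j => ∫ ω, Matrix.vecMulVec (y ω) (star (y ω)) i j ∂P

/-- The normalization `r / ((1/m) tr E[y yᴴ])` of a transmitted vector `y` with `m` entries to the
power budget `r`. The trace is a real number, which is read off by `Complex.re`. -/
def powerFactor (P : Measure Ω) (r : ℝ) {m : ℕ} (y : Ω → Fin m → ℂ) : ℝ :=
  r / ((1 / (m : ℝ)) * (secondMoment P y).trace.re)

/-- For *fixed* channel matrices `h`, the pair consisting of the vector that node `k` retransmits and
its power normalization factor. Node `0` is the source, with vector `x`; for `k ≥ 1` the vector
is the received signal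
`y_k = √α_k H_k √(β_{k-1} / n_{k-1}) y_{k-1} + w_k` (with `y_0 = x`).
Node `k` has `d k` antennas, `h k` is the channel matrix `H_{k+1}` from node `k` to node `k + 1`,
and `w k` is the noise vector `w_{k+1}` at node `k + 1`. Since `h` is fixed, the expectations in the
normalization factors are over `x` and `w` only. -/
def node (P : Measure Ω) (α ρ : ℕ → ℝ) (d : ℕ → ℕ)
    (h : ∀ k, Matrix (Fin (d (k + 1))) (Fin (d k)) ℂ)
    (x : Ω → Fin (d 0) → ℂ) (w : ∀ k, Ω → Fin (d (k + 1)) → ℂ) :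
    ∀ k : ℕ, (Ω → Fin (d k) → ℂ) × ℝ
  | 0 => (x, powerFactor P (ρ 0) x)
  | k + 1 =>
    let y : Ω → Fin (d k) → ℂ := (node P α ρ d h x w k).1
    let β : ℝ := (node P α ρ d h x w k).2
    let y' : Ω → Fin (d (k + 1)) → ℂ := fun ω =>
      (√(α (k + 1)) : ℂ) • (h k).mulVec ((√(β / d k) : ℂ) • y ω) + w k ω
    (y', powerFactor P (ρ (k + 1)) y')

/-- The random power normalization factor `β_k`: a function of the realization `H(ω)` of the channel
matrices, the expectation being taken over the transmit vector and the noise vectors only. -/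
def beta (P : Measure Ω) (α ρ : ℕ → ℝ) (d : ℕ → ℕ)
    (H : ∀ k, Ω → Matrix (Fin (d (k + 1))) (Fin (d k)) ℂ)
    (x : Ω → Fin (d 0) → ℂ) (w : ∀ k, Ω → Fin (d (k + 1)) → ℂ) (k : ℕ) (ω : Ω) : ℝ :=
  (node P α ρ d (fun j => H j ω) x w k).2

/-- The positions of all scalar entries of `H_1, …, H_K`, of `x`, and of `w_1, …, w_K`. -/
abbrev EntryIndex (K : ℕ) (d : ℕ → ℕ) : Type :=
  (Σ k : Fin K, Fin (d (k + 1)) × Fin (d k)) ⊕ Fin (d 0) ⊕ (Σ k : Fin K, Fin (d (k + 1)))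

/-- The family of all scalar entries of `H_1, …, H_K`, of `x`, and of `w_1, …, w_K`. -/
def entry (K : ℕ) (d : ℕ → ℕ)
    (H : ∀ k, Ω → Matrix (Fin (d (k + 1))) (Fin (d k)) ℂ)
    (x : Ω → Fin (d 0) → ℂ) (w : ∀ k, Ω → Fin (d (k + 1)) → ℂ) :
    EntryIndex K d → Ω → ℂ
  | .inl ⟨k, i, j⟩ => fun ω => H k ω i j
  | .inr (.inl i) => fun ω => x ω i
  | .inr (.inr ⟨k, i⟩) => fun ω => w k ω i

/-- The randomness of the `K`-hop relay model at one system size: the matrices `H_1, …, H_K` are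
standard complex Gaussian, `x` and the noise vectors `w_1, …, w_K` are `CN(0, I)`, and all of these
are mutually independent. -/
structure IsGaussianModel (P : Measure Ω) (K : ℕ) (d : ℕ → ℕ)
    (H : ∀ k, Ω → Matrix (Fin (d (k + 1))) (Fin (d k)) ℂ)
    (x : Ω → Fin (d 0) → ℂ) (w : ∀ k, Ω → Fin (d (k + 1)) → ℂ) : Prop where
  law : ∀ e, HasLaw (entry K d H x w e) stdComplexGaussian P
  indep : iIndepFun (entry K d H x w) P

end Relay

end

/-! Fix the channels. The noise is uncorrelated with the incoming signal, so the second moment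
matrices satisfy Q_0 = I and Q_{k+1} = (α_{k+1} ρ_k / tr Q_k) H_{k+1} Q_k H_{k+1}ᴴ + I
(`secondMoment_node`). Hence β_{k+1} = ρ_{k+1} / (1 + α_{k+1} ρ_k g_k) with g_k = tr(H_{k+1} Q_k
H_{k+1}ᴴ) / (n_{k+1} tr Q_k) (`node_succ_snd`), and it remains to show g_k → 1 almost surely.

Now let the channels vary. Q_k depends on H_1, …, H_k only, so it is independent of H_{k+1}. Given
Q_k, g_k is an average over the n_{k+1} independent rows of quadratic forms divided by tr Q_k. Each
has mean 1 and, by convexity, a fourth moment below an absolute constant, whatever Q_k is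
(`integral_quadForm_div_trace_pow_four_le`). No control of the spectrum of Q_k, nor of the earlier
limits, is needed.

Therefore E(g_k - 1)^4 = O(n_{k+1}^{-2}) (`lintegral_gain_cov_le`). The limsup bounds give n_{k+1} ≥
c n eventually, so these moments are summable in n, which yields almost sure convergence under any
joint law across n. -/

noncomputable section

namespace Relay

variable {Ω : Type*} [MeasurableSpace Ω]

/-! ### Moments of complex Gaussian variables and of their linear forms. -/

section Gaussian

variable {P : Measure Ω} {X Y : Ω → ℂ}

lemma hasLaw_re (hX : HasLaw X stdComplexGaussian P) :
    HasLaw (fun ω => (X ω).re) (gaussianReal 0 (1 / 2)) P := by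
  refine ⟨Complex.measurable_re.comp_aemeasurable hX.aemeasurable, ?_⟩
  have h : (fun ω => (X ω).re) = Complex.re ∘ X := rfl
  rw [h, ← AEMeasurable.map_map_of_aemeasurable Complex.measurable_re.aemeasurable hX.aemeasurable,
    hX.map_eq, stdComplexGaussian, Measure.map_map Complex.measurable_re (MeasurableEquiv.measurable _)]
  have h2 : Complex.re ∘ Complex.measurableEquivRealProd.symm = Prod.fst := by
    ext p; simp
  rw [h2, Measure.map_fst_prod]
  simp

lemma hasLaw_im (hX : HasLaw X stdComplexGaussian P) :
    HasLaw (fun ω => (X ω).im) (gaussianReal 0 (1 / 2)) P := by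
  refine ⟨Complex.measurable_im.comp_aemeasurable hX.aemeasurable, ?_⟩
  have h : (fun ω => (X ω).im) = Complex.im ∘ X := rfl
  rw [h, ← AEMeasurable.map_map_of_aemeasurable Complex.measurable_im.aemeasurable hX.aemeasurable,
    hX.map_eq, stdComplexGaussian, Measure.map_map Complex.measurable_im (MeasurableEquiv.measurable _)]
  have h2 : Complex.im ∘ Complex.measurableEquivRealProd.symm = Prod.snd := by
    ext p; simp
  rw [h2, Measure.map_snd_prod]
  simp

lemma hasSubgaussianMGF_of_hasLaw_gaussianReal {Z : Ω → ℝ} {v : ℝ≥0}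
    (hZ : HasLaw Z (gaussianReal 0 v) P) : HasSubgaussianMGF Z v P := by
  refine ⟨fun t => ?_, fun t => ?_⟩
  · have h := integrable_exp_mul_gaussianReal (μ := 0) (v := v) t
    rw [← hZ.map_eq] at h
    exact h.comp_aemeasurable hZ.aemeasurable
  · rw [mgf_gaussianReal hZ.map_eq]
    simp

lemma memLp_of_hasLaw (hX : HasLaw X stdComplexGaussian P) (p : ℝ≥0) : MemLp X p P := by
  have h1 := (hasSubgaussianMGF_of_hasLaw_gaussianReal (hasLaw_re hX)).memLp p
  have h2 := (hasSubgaussianMGF_of_hasLaw_gaussianReal (hasLaw_im hX)).memLp p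
  exact memLp_re_im_iff.1 ⟨h1, h2⟩

lemma integral_gaussianReal_sq {Z : Ω → ℝ} {v : ℝ≥0} (hZ : HasLaw Z (gaussianReal 0 v) P) :
    ∫ ω, Z ω ^ 2 ∂P = v := by
  have h := variance_fun_id_gaussianReal (μ := 0) (v := v)
  rw [variance_eq_integral (by fun_prop)] at h
  simp only [integral_id_gaussianReal, sub_zero] at h
  rw [← h, ← hZ.map_eq, integral_map hZ.aemeasurable (by fun_prop)]

lemma integral_eq_zero_of_hasLaw_gaussianReal {Z : Ω → ℝ} {v : ℝ≥0}
    (hZ : HasLaw Z (gaussianReal 0 v) P) : ∫ ω, Z ω ∂P = 0 := by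
  rw [hZ.integral_eq]
  exact integral_id_gaussianReal

lemma integral_eq_zero_of_hasLaw (hX : HasLaw X stdComplexGaussian P) [IsFiniteMeasure P] :
    ∫ ω, X ω ∂P = 0 := by
  have hi : Integrable X P := (memLp_of_hasLaw hX 1).integrable (by simp)
  apply Complex.ext
  · have := integral_re hi
    simp only [RCLike.re_to_complex] at this
    rw [← this, integral_eq_zero_of_hasLaw_gaussianReal (hasLaw_re hX), Complex.zero_re]
  · have := integral_im hi
    simp only [RCLike.im_to_complex] at this
    rw [← this, integral_eq_zero_of_hasLaw_gaussianReal (hasLaw_im hX), Complex.zero_im]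

lemma integral_mul_star_self_of_hasLaw (hX : HasLaw X stdComplexGaussian P) :
    ∫ ω, X ω * star (X ω) ∂P = 1 := by
  have h1 := (hasSubgaussianMGF_of_hasLaw_gaussianReal (hasLaw_re hX)).memLp 2
  have h2 := (hasSubgaussianMGF_of_hasLaw_gaussianReal (hasLaw_im hX)).memLp 2
  have h : ∀ ω, X ω * star (X ω) = (((X ω).re ^ 2 + (X ω).im ^ 2 : ℝ) : ℂ) := by
    intro ω
    have := Complex.mul_conj (X ω)
    simp only [Complex.normSq_apply] at this
    rw [← starRingEnd_apply, this]
    congr 1; ring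
  simp_rw [h]
  rw [integral_complex_ofReal, integral_add h1.integrable_sq h2.integrable_sq,
    integral_gaussianReal_sq (hasLaw_re hX), integral_gaussianReal_sq (hasLaw_im hX)]
  norm_num

lemma integral_mul_star_of_indepFun [IsFiniteMeasure P] (hX : HasLaw X stdComplexGaussian P)
    (hY : HasLaw Y stdComplexGaussian P) (h : IndepFun X Y P) :
    ∫ ω, X ω * star (Y ω) ∂P = 0 := by
  have h' : IndepFun X (fun ω => star (Y ω)) P :=
    h.comp measurable_id continuous_star.measurable
  rw [h'.integral_fun_mul_eq_mul_integral hX.aemeasurable.aestronglyMeasurable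
    (continuous_star.measurable.comp_aemeasurable hY.aemeasurable).aestronglyMeasurable,
    integral_eq_zero_of_hasLaw hX, zero_mul]

lemma hasSubgaussianMGF_mono {Z : Ω → ℝ} {c c' : ℝ≥0} (hZ : HasSubgaussianMGF Z c P)
    (h : c ≤ c') : HasSubgaussianMGF Z c' P := by
  refine ⟨hZ.integrable_exp_mul, fun t => (hZ.mgf_le t).trans ?_⟩
  have : (c : ℝ) ≤ c' := h
  gcongr

/-- The subgaussian sum bound valid without independence gives (|Re b| + |Im b|)² / 2 ≤ ‖b‖². This
loses at most a factor 2 against the exact variance ‖b‖² / 2. -/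
lemma hasSubgaussianMGF_re_mul (hX : HasLaw X stdComplexGaussian P) (b : ℂ) :
    HasSubgaussianMGF (fun ω => (b * X ω).re) (‖b‖₊ ^ 2) P := by
  have h1 := (hasSubgaussianMGF_of_hasLaw_gaussianReal (hasLaw_re hX)).const_mul b.re
  have h2 := (hasSubgaussianMGF_of_hasLaw_gaussianReal (hasLaw_im hX)).const_mul (-b.im)
  refine hasSubgaussianMGF_mono ((h1.add h2).congr (ae_of_all _ fun ω => ?_)) ?_
  · simp [Complex.mul_re]; ring
  · rw [← NNReal.coe_le_coe]
    push_cast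
    rw [Complex.sq_norm, Complex.normSq_apply]
    set s := √(b.re ^ 2 * (1 / 2)) with hs
    set t := √((-b.im) ^ 2 * (1 / 2)) with ht
    have e1 : s ^ 2 = b.re ^ 2 * (1 / 2) := Real.sq_sqrt (by positivity)
    have e2 : t ^ 2 = (-b.im) ^ 2 * (1 / 2) := Real.sq_sqrt (by positivity)
    have : (s + t) ^ 2 ≤ b.re * b.re + b.im * b.im := by nlinarith [sq_nonneg (s - t)]
    exact this

lemma integral_pow_eight_le_of_hasSubgaussianMGF {Z : Ω → ℝ} (hZ : HasSubgaussianMGF Z 1 P) :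
    ∫ ω, Z ω ^ 8 ∂P ≤ 200000 := by
  -- One term of the exponential series, with 40320 = 8!. Since e^{1/2} < 2, the final bound is 4 ·
  -- 8! = 161280.
  have hb : ∀ z : ℝ, z ^ 8 ≤ 40320 * (Real.exp (1 * z) + Real.exp (-1 * z)) := by
    intro z
    have h1 := Real.pow_div_factorial_le_exp _ (abs_nonneg z) 8
    have h2 : |z| ^ 8 = z ^ 8 := by rw [Even.pow_abs (by decide)]
    have h3 : ((Nat.factorial 8 : ℕ) : ℝ) = 40320 := by norm_num [Nat.factorial]
    rw [h2, h3, div_le_iff₀ (by norm_num)] at h1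
    have h4 : Real.exp |z| ≤ Real.exp (1 * z) + Real.exp (-1 * z) := by
      rcases abs_cases z with ⟨h, _⟩ | ⟨h, _⟩ <;> rw [h]
      · rw [one_mul]; linarith [Real.exp_pos (-1 * z)]
      · rw [neg_one_mul]; linarith [Real.exp_pos (1 * z)]
    linarith
  have h_int := (hZ.integrable_exp_mul 1).add (hZ.integrable_exp_mul (-1))
  calc ∫ ω, Z ω ^ 8 ∂P ≤ ∫ ω, 40320 * (Real.exp (1 * Z ω) + Real.exp (-1 * Z ω)) ∂P := by
        refine integral_mono_of_nonneg (ae_of_all _ fun ω => ?_) (h_int.const_mul _)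
          (ae_of_all _ fun ω => hb _)
        exact Even.pow_nonneg (by decide) _
    _ = 40320 * (mgf Z P 1 + mgf Z P (-1)) := by
        rw [integral_const_mul, integral_add (hZ.integrable_exp_mul 1) (hZ.integrable_exp_mul (-1))]
        rfl
    _ ≤ 40320 * (Real.exp (1 / 2) + Real.exp (1 / 2)) := by
        have h1 := hZ.mgf_le 1
        have h2 := hZ.mgf_le (-1)
        norm_num at h1 h2 ⊢
        linarith
    _ ≤ 200000 := by
        have h : Real.exp (1 / 2) ^ 2 = Real.exp 1 := by
          rw [← Real.exp_nat_mul]; norm_num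
        have := Real.exp_one_lt_d9
        have : Real.exp (1 / 2) < 2 := by nlinarith [Real.exp_pos (1 / 2 : ℝ)]
        linarith

variable {ι : Type*} [Fintype ι] {A : ι → Ω → ℂ}

lemma hasSubgaussianMGF_re_sum (hA : ∀ i, HasLaw (A i) stdComplexGaussian P)
    (hind : iIndepFun A P) {b : ι → ℂ} (hb : ∑ i, ‖b i‖ ^ 2 ≤ 1) :
    HasSubgaussianMGF (fun ω => (∑ i, b i * A i ω).re) 1 P := by
  have hi : iIndepFun (fun i ω => (b i * A i ω).re) P :=
    hind.comp (fun i z => (b i * z).re) fun i => by fun_prop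
  have h := HasSubgaussianMGF.sum_of_iIndepFun hi (s := Finset.univ)
    fun i _ => hasSubgaussianMGF_re_mul (hA i) (b i)
  refine hasSubgaussianMGF_mono (h.congr (ae_of_all _ fun ω => ?_)) ?_
  · simp only [Complex.re_sum]
  · rw [← NNReal.coe_le_coe]
    simpa using hb

lemma hasSubgaussianMGF_im_sum (hA : ∀ i, HasLaw (A i) stdComplexGaussian P)
    (hind : iIndepFun A P) {b : ι → ℂ} (hb : ∑ i, ‖b i‖ ^ 2 ≤ 1) :
    HasSubgaussianMGF (fun ω => (∑ i, b i * A i ω).im) 1 P := by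
  have h := hasSubgaussianMGF_re_sum hA hind (b := fun i => -Complex.I * b i) (by simpa using hb)
  refine h.congr (ae_of_all _ fun ω => ?_)
  simp only [mul_assoc, ← Finset.mul_sum]
  simp

/-- The eighth absolute moment of a linear form in independent standard complex Gaussian variables
is bounded by an absolute multiple of the eighth power of the norm of its coefficients. -/
lemma integral_norm_sum_pow_eight_le (hA : ∀ i, HasLaw (A i) stdComplexGaussian P)
    (hind : iIndepFun A P) {b : ι → ℂ} (hb : ∑ i, ‖b i‖ ^ 2 ≤ 1) :
    ∫ ω, (‖∑ i, b i * A i ω‖ ^ 2) ^ 4 ∂P ≤ 3200000 := by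
  have h1 := hasSubgaussianMGF_re_sum hA hind hb
  have h2 := hasSubgaussianMGF_im_sum hA hind hb
  have i1 : Integrable (fun ω => (∑ i, b i * A i ω).re ^ 8) P := by
    have := (h1.memLp 8).integrable_norm_pow (p := 8) (by norm_num)
    exact this.congr (ae_of_all _ fun ω => by
      simp only [Real.norm_eq_abs]; rw [Even.pow_abs (by decide)])
  have i2 : Integrable (fun ω => (∑ i, b i * A i ω).im ^ 8) P := by
    have := (h2.memLp 8).integrable_norm_pow (p := 8) (by norm_num)
    exact this.congr (ae_of_all _ fun ω => by
      simp only [Real.norm_eq_abs]; rw [Even.pow_abs (by decide)])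
  -- (a + b)^4 ≤ 2^3 (a^4 + b^4) with a, b the squared real and imaginary parts; 3200000 = 8 · 2 ·
  -- 200000.
  calc _ ≤ ∫ ω, 8 * ((∑ i, b i * A i ω).re ^ 8 + (∑ i, b i * A i ω).im ^ 8) ∂P := by
        refine integral_mono_of_nonneg (ae_of_all _ fun ω => by positivity)
          ((i1.add i2).const_mul 8) (ae_of_all _ fun ω => ?_)
        simp only
        rw [Complex.sq_norm, Complex.normSq_apply]
        have := add_pow_le (sq_nonneg (∑ i, b i * A i ω).re) (sq_nonneg (∑ i, b i * A i ω).im) 4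
        convert this using 1 <;> ring
    _ = 8 * (∫ ω, (∑ i, b i * A i ω).re ^ 8 ∂P + ∫ ω, (∑ i, b i * A i ω).im ^ 8 ∂P) := by
        rw [integral_const_mul, integral_add i1 i2]
    _ ≤ _ := by
        linarith [integral_pow_eight_le_of_hasSubgaussianMGF h1,
          integral_pow_eight_le_of_hasSubgaussianMGF h2]

end Gaussian

/-! ### Fourth moments of sums of independent centred variables. -/

section FourthMoment

variable {P : Measure Ω} {ι : Type*} {Z : ι → Ω → ℝ} {C : ℝ}

lemma integrable_pow_of_memLp_four [IsFiniteMeasure P] {S : Ω → ℝ} (hS : MemLp S 4 P) {a : ℕ}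
    (ha : a ≤ 4) : Integrable (fun ω => S ω ^ a) P := by
  have h : MemLp S a P := hS.mono_exponent (by exact_mod_cast ha)
  have h2 := h.integrable_norm_pow'
  refine (integrable_norm_iff (hS.1.pow a)).1 ?_
  simpa using h2

/-- Fourth moment bound for a sum of independent centred random variables. -/
lemma integral_sum_pow_four_le [IsProbabilityMeasure P] (hC : 1 ≤ C)
    (hL : ∀ i, MemLp (Z i) 4 P) (hmean : ∀ i, ∫ ω, Z i ω ∂P = 0)
    (h4 : ∀ i, ∫ ω, Z i ω ^ 4 ∂P ≤ C)
    (hind : ∀ (s : Finset ι) (i : ι), i ∉ s → IndepFun (fun ω => ∑ j ∈ s, Z j ω) (Z i) P)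
    (s : Finset ι) :
    ∫ ω, (∑ i ∈ s, Z i ω) ^ 4 ∂P ≤ 3 * C ^ 2 * (s.card : ℝ) ^ 2 := by
  classical
  have hSL : ∀ s : Finset ι, MemLp (fun ω => ∑ i ∈ s, Z i ω) 4 P := fun s =>
    memLp_finsetSum s fun i _ => hL i
  have hSm : ∀ s : Finset ι, ∫ ω, ∑ i ∈ s, Z i ω ∂P = 0 := fun s => by
    rw [integral_finsetSum _ fun i _ => (hL i).integrable (by norm_num)]
    simp [hmean]
  -- t² ≤ (1 + t⁴) / 2, and (1 + C) / 2 ≤ C because 1 ≤ C.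
  have h2 : ∀ i, ∫ ω, Z i ω ^ 2 ∂P ≤ C := fun i => by
    calc ∫ ω, Z i ω ^ 2 ∂P ≤ ∫ ω, (1 / 2 + 1 / 2 * Z i ω ^ 4) ∂P := by
          refine integral_mono (integrable_pow_of_memLp_four (hL i) (by norm_num))
            ((integrable_const _).add
              ((integrable_pow_of_memLp_four (hL i) le_rfl).const_mul _)) fun ω => ?_
          simp only
          nlinarith [sq_nonneg (Z i ω ^ 2 - 1)]
      _ = 1 / 2 + 1 / 2 * ∫ ω, Z i ω ^ 4 ∂P := by
          rw [integral_add (integrable_const _)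
            ((integrable_pow_of_memLp_four (hL i) le_rfl).const_mul _), integral_const_mul]
          simp
      _ ≤ C := by linarith [h4 i]
  have hmul : ∀ (s : Finset ι) (i : ι), i ∉ s → ∀ a b : ℕ, a ≤ 4 → b ≤ 4 →
      Integrable (fun ω => (∑ j ∈ s, Z j ω) ^ a * Z i ω ^ b) P ∧
      ∫ ω, (∑ j ∈ s, Z j ω) ^ a * Z i ω ^ b ∂P =
        (∫ ω, (∑ j ∈ s, Z j ω) ^ a ∂P) * ∫ ω, Z i ω ^ b ∂P := by
    intro s i hi a b ha hb
    have hI : IndepFun (fun ω => (∑ j ∈ s, Z j ω) ^ a) (fun ω => Z i ω ^ b) P :=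
      (hind s i hi).comp (φ := fun z => z ^ a) (ψ := fun z => z ^ b) (by fun_prop) (by fun_prop)
    have i1 := integrable_pow_of_memLp_four (hSL s) ha
    have i2 := integrable_pow_of_memLp_four (hL i) hb
    exact ⟨hI.integrable_mul i1 i2, hI.integral_fun_mul_eq_mul_integral i1.1 i2.1⟩
  -- The second moment joins the induction because the fourth moment grows by 6 E S² E Z² + E Z⁴ ≤
  -- 6C²m + C, which is at most 3C²((m + 1)² - m²).
  suffices h : ∫ ω, (∑ i ∈ s, Z i ω) ^ 2 ∂P ≤ C * s.card ∧
      ∫ ω, (∑ i ∈ s, Z i ω) ^ 4 ∂P ≤ 3 * C ^ 2 * (s.card : ℝ) ^ 2 from h.2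
  induction s using Finset.induction_on with
  | empty => simp
  | insert i s hi ih =>
    obtain ⟨ih2, ih4⟩ := ih
    have hm := hmul s i hi
    simp only [Finset.sum_insert hi, Finset.card_insert_of_notMem hi]
    -- Trivial exponents 0 and 1 are kept so that `hmul` applies to every term.
    have e2 : ∀ ω, (Z i ω + ∑ j ∈ s, Z j ω) ^ 2 = (∑ j ∈ s, Z j ω) ^ 2 * Z i ω ^ 0 +
        2 * ((∑ j ∈ s, Z j ω) ^ 1 * Z i ω ^ 1) + (∑ j ∈ s, Z j ω) ^ 0 * Z i ω ^ 2 := fun ω => by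
      ring
    have e4 : ∀ ω, (Z i ω + ∑ j ∈ s, Z j ω) ^ 4 = (∑ j ∈ s, Z j ω) ^ 4 * Z i ω ^ 0 +
        4 * ((∑ j ∈ s, Z j ω) ^ 3 * Z i ω ^ 1) + 6 * ((∑ j ∈ s, Z j ω) ^ 2 * Z i ω ^ 2) +
        4 * ((∑ j ∈ s, Z j ω) ^ 1 * Z i ω ^ 3) + (∑ j ∈ s, Z j ω) ^ 0 * Z i ω ^ 4 := fun ω => by
      ring
    have I2 : ∫ ω, (Z i ω + ∑ j ∈ s, Z j ω) ^ 2 ∂P =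
        ∫ ω, (∑ j ∈ s, Z j ω) ^ 2 ∂P + ∫ ω, Z i ω ^ 2 ∂P := by
      simp_rw [e2]
      rw [integral_add (by
          exact (hm 2 0 (by norm_num) (by norm_num)).1.add
            ((hm 1 1 (by norm_num) (by norm_num)).1.const_mul 2))
          (hm 0 2 (by norm_num) (by norm_num)).1,
        integral_add (hm 2 0 (by norm_num) (by norm_num)).1
            ((hm 1 1 (by norm_num) (by norm_num)).1.const_mul 2), integral_const_mul,
        (hm 1 1 (by norm_num) (by norm_num)).2]
      simp [hmean]
    have I4 : ∫ ω, (Z i ω + ∑ j ∈ s, Z j ω) ^ 4 ∂P =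
        ∫ ω, (∑ j ∈ s, Z j ω) ^ 4 ∂P +
          6 * ((∫ ω, (∑ j ∈ s, Z j ω) ^ 2 ∂P) * ∫ ω, Z i ω ^ 2 ∂P) + ∫ ω, Z i ω ^ 4 ∂P := by
      have t1 := (hm 4 0 (by norm_num) (by norm_num)).1
      have t2 := (hm 3 1 (by norm_num) (by norm_num)).1.const_mul 4
      have t3 := (hm 2 2 (by norm_num) (by norm_num)).1.const_mul 6
      have t4 := (hm 1 3 (by norm_num) (by norm_num)).1.const_mul 4
      have t5 := (hm 0 4 (by norm_num) (by norm_num)).1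
      simp_rw [e4]
      rw [integral_add (by exact ((t1.add t2).add t3).add t4) t5,
        integral_add (by exact (t1.add t2).add t3) t4, integral_add (by exact t1.add t2) t3,
        integral_add t1 t2]
      simp only [integral_const_mul]
      rw [(hm 3 1 (by norm_num) (by norm_num)).2, (hm 2 2 (by norm_num) (by norm_num)).2,
        (hm 1 3 (by norm_num) (by norm_num)).2]
      simp [hmean, hSm]
    rw [I2, I4]
    push_cast
    have p1 : 0 ≤ ∫ ω, (∑ j ∈ s, Z j ω) ^ 2 ∂P := integral_nonneg fun ω => sq_nonneg _
    have p2 : 0 ≤ ∫ ω, Z i ω ^ 2 ∂P := integral_nonneg fun ω => sq_nonneg _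
    refine ⟨by linarith [h2 i], ?_⟩
    have p3 := mul_le_mul ih2 (h2 i) p2 (by positivity)
    have p4 : C ≤ C ^ 2 := by nlinarith
    nlinarith [h4 i, sq_nonneg C]

end FourthMoment

/-! ### Gaussian quadratic forms with a positive semidefinite matrix. -/

section QuadraticForm

open scoped ComplexOrder

variable {ι κ : Type*} [Fintype ι] [Fintype κ]

/-- The real part of `∑ a b, z a * q a b * conj (z b)`. -/
def quadForm (q : Matrix ι ι ℂ) (z : ι → ℂ) : ℝ :=
  (z ⬝ᵥ q.mulVec (star z)).re

lemma quadForm_sum_vecMulVec (v : κ → ι → ℂ) (z : ι → ℂ) :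
    quadForm (∑ l, Matrix.vecMulVec (v l) (star (v l))) z = ∑ l, ‖∑ a, v l a * z a‖ ^ 2 := by
  simp only [quadForm, Matrix.sum_mulVec, dotProduct_sum, Complex.re_sum]
  refine Finset.sum_congr rfl fun l _ => ?_
  rw [Matrix.vecMulVec_mulVec, dotProduct_smul, Matrix.star_dotProduct_star]
  have h : z ⬝ᵥ v l = ∑ a, v l a * z a := by
    simp [dotProduct, mul_comm]
  rw [h, op_smul_eq_mul, ← starRingEnd_apply, Complex.mul_conj,
    Complex.ofReal_re, Complex.sq_norm]

lemma trace_re_sum_vecMulVec (v : κ → ι → ℂ) :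
    (∑ l, Matrix.vecMulVec (v l) (star (v l))).trace.re = ∑ l, ∑ a, ‖v l a‖ ^ 2 := by
  rw [Matrix.trace_sum, Complex.re_sum]
  refine Finset.sum_congr rfl fun l _ => ?_
  simp only [Matrix.trace, Complex.re_sum, Matrix.diag_apply, Matrix.vecMulVec_apply,
    Pi.star_apply]
  refine Finset.sum_congr rfl fun a _ => ?_
  rw [← starRingEnd_apply, Complex.mul_conj, Complex.ofReal_re, Complex.sq_norm]

variable {P : Measure Ω} {A : ι → Ω → ℂ}

lemma memLp_quadForm (hA : ∀ i, HasLaw (A i) stdComplexGaussian P) (q : Matrix ι ι ℂ) :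
    MemLp (fun ω => quadForm q fun i => A i ω) 4 P := by
  -- Hölder: products of two L⁸ entries lie in L⁴.
  have : ENNReal.HolderTriple 8 8 4 := ⟨by
    rw [← two_mul, show (8 : ℝ≥0∞) = 2 * 4 by norm_num,
      ENNReal.mul_inv (by simp) (by simp), ← mul_assoc, ENNReal.mul_inv_cancel (by simp) (by simp),
      one_mul]⟩
  have h8 : ∀ i, MemLp (A i) 8 P := fun i => memLp_of_hasLaw (hA i) 8
  have h : MemLp (fun ω => ∑ a, ∑ b, A a ω * (q a b * star (A b ω))) 4 P :=
    memLp_finsetSum _ fun a _ => memLp_finsetSum _ fun b _ =>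
      MemLp.mul (p := 8) (q := 8) ((h8 b).star.const_mul (q a b)) (h8 a)
  convert h.re using 2 with ω
  simp [quadForm, dotProduct, Matrix.mulVec, Finset.mul_sum]

lemma integral_quadForm [IsProbabilityMeasure P] (hA : ∀ i, HasLaw (A i) stdComplexGaussian P)
    (hind : iIndepFun A P) (q : Matrix ι ι ℂ) :
    ∫ ω, quadForm q (fun i => A i ω) ∂P = q.trace.re := by
  classical
  have h2 : ∀ i, MemLp (A i) 2 P := fun i => memLp_of_hasLaw (hA i) 2
  have h_int : ∀ a b, Integrable (fun ω => q a b * (A a ω * star (A b ω))) P := fun a b =>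
    ((h2 a).integrable_mul (h2 b).star).const_mul _
  have hab : ∀ a b, ∫ ω, A a ω * star (A b ω) ∂P = if a = b then 1 else 0 := by
    intro a b
    split_ifs with h
    · rw [← h]; exact integral_mul_star_self_of_hasLaw (hA a)
    · exact integral_mul_star_of_indepFun (hA a) (hA b) (hind.indepFun h)
  have e : ∀ ω, quadForm q (fun i => A i ω) =
      (∑ a, ∑ b, q a b * (A a ω * star (A b ω))).re := by
    intro ω
    simp only [quadForm, dotProduct, Matrix.mulVec, Finset.mul_sum, Pi.star_apply]
    congr 1
    exact Finset.sum_congr rfl fun a _ => Finset.sum_congr rfl fun b _ => by ring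
  have hI : Integrable (fun ω => ∑ a, ∑ b, q a b * (A a ω * star (A b ω))) P :=
    integrable_finsetSum _ fun a _ => integrable_finsetSum _ fun b _ => h_int a b
  simp_rw [e]
  have := integral_re hI
  simp only [RCLike.re_to_complex] at this
  rw [this, integral_finsetSum _ fun a _ => integrable_finsetSum _ fun b _ => h_int a b]
  congr 1
  simp only [Matrix.trace, Matrix.diag_apply]
  refine Finset.sum_congr rfl fun a _ => ?_
  rw [integral_finsetSum _ fun b _ => h_int a b]
  simp only [integral_const_mul, hab]
  simp

lemma quadForm_nonneg {q : Matrix ι ι ℂ} (hq : q.PosSemidef) (z : ι → ℂ) : 0 ≤ quadForm q z := by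
  obtain ⟨m, v, rfl⟩ := Matrix.posSemidef_iff_eq_sum_vecMulVec.1 hq
  rw [quadForm_sum_vecMulVec]
  positivity

/-- Write q as a sum of rank-one matrices. The normalized form is then a convex combination, with
weights t l / T, of squared linear forms with coefficient norm at most 1, and Jensen's inequality
for the fourth power gives a bound free of dimension and spectrum. -/
lemma integral_quadForm_div_trace_pow_four_le (hA : ∀ i, HasLaw (A i) stdComplexGaussian P)
    (hind : iIndepFun A P) {q : Matrix ι ι ℂ} (hq : q.PosSemidef) (ht : 0 < q.trace.re) :
    ∫ ω, (quadForm q (fun i => A i ω) / q.trace.re) ^ 4 ∂P ≤ 3200000 := by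
  obtain ⟨m, v, rfl⟩ := Matrix.posSemidef_iff_eq_sum_vecMulVec.1 hq
  rw [trace_re_sum_vecMulVec] at ht ⊢
  simp_rw [quadForm_sum_vecMulVec]
  set t : Fin m → ℝ := fun l => ∑ a, ‖v l a‖ ^ 2 with htdef
  set T := ∑ l, t l with hT
  have ht0 : ∀ l, 0 ≤ t l := fun l => by positivity
  -- If t l = 0, the inverse is 0 and b l vanishes; hence an inequality, not an equality, in `hb`.
  let b : Fin m → ι → ℂ := fun l a => ((√(t l))⁻¹ : ℝ) * v l a
  have hb : ∀ l, ∑ a, ‖b l a‖ ^ 2 ≤ 1 := fun l => by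
    simp only [b, norm_mul, mul_pow, ← Finset.mul_sum, Complex.norm_real, norm_inv, Real.norm_eq_abs,
      sq_abs, inv_pow, Real.sq_sqrt (ht0 l)]
    exact inv_mul_le_one
  have hwz : ∀ l ω, ‖∑ a, v l a * A a ω‖ ^ 2 / T = t l / T * ‖∑ a, b l a * A a ω‖ ^ 2 := by
    intro l ω
    rcases (ht0 l).eq_or_lt with h | h
    · have : ∀ a, v l a = 0 := fun a => by
        have := (Finset.sum_eq_zero_iff_of_nonneg fun a _ => by positivity).1 h.symm a
          (Finset.mem_univ a)
        simpa using this
      simp [this, ← h]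
    · have : ∑ a, b l a * A a ω = ((√(t l))⁻¹ : ℝ) * ∑ a, v l a * A a ω := by
        simp only [b, Finset.mul_sum, mul_assoc]
      rw [this, norm_mul, mul_pow, Complex.norm_real, norm_inv, Real.norm_eq_abs, inv_pow, sq_abs,
        Real.sq_sqrt (ht0 l)]
      field_simp
  have h_int : ∀ l, Integrable (fun ω => (‖∑ a, b l a * A a ω‖ ^ 2) ^ 4) P := fun l => by
    have h : MemLp (fun ω => ∑ a, b l a * A a ω) 8 P := memLp_finsetSum _ fun a _ =>
      (memLp_of_hasLaw (hA a) 8).const_mul _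
    have := h.integrable_norm_pow (p := 8) (by norm_num)
    exact this.congr (ae_of_all _ fun ω => by simp only; ring)
  calc ∫ ω, ((∑ l, ‖∑ a, v l a * A a ω‖ ^ 2) / T) ^ 4 ∂P
      ≤ ∫ ω, ∑ l, t l / T * (‖∑ a, b l a * A a ω‖ ^ 2) ^ 4 ∂P := by
        refine integral_mono_of_nonneg (ae_of_all _ fun ω => by positivity)
          (integrable_finsetSum _ fun l _ => (h_int l).const_mul _) (ae_of_all _ fun ω => ?_)
        simp only
        rw [Finset.sum_div]
        simp_rw [hwz]
        refine Real.pow_arith_mean_le_arith_mean_pow _ _ _ (fun l _ => by have := ht0 l; positivity)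
          ?_ (fun l _ => by positivity) 4
        rw [← Finset.sum_div, div_self ht.ne']
    _ = ∑ l, t l / T * ∫ ω, (‖∑ a, b l a * A a ω‖ ^ 2) ^ 4 ∂P := by
        rw [integral_finsetSum _ fun l _ => (h_int l).const_mul _]
        simp only [integral_const_mul]
    _ ≤ ∑ l, t l / T * 3200000 := by
        refine Finset.sum_le_sum fun l _ => ?_
        have := ht0 l
        exact mul_le_mul_of_nonneg_left (integral_norm_sum_pow_eight_le hA hind (hb l))
          (by positivity)
    _ = 3200000 := by
        rw [← Finset.sum_mul, ← Finset.sum_div, div_self ht.ne', one_mul]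

end QuadraticForm

/-! ### Independence of disjoint blocks of entries, and conditioning. -/

section Independence

variable {P : Measure Ω} {ι E F : Type*} [MeasurableSpace E] [MeasurableSpace F]

lemma indepFun_of_measurable_iSup_comap {f : ι → Ω → ℂ} (hf : ∀ i, Measurable (f i))
    (hind : iIndepFun f P) {S T : Set ι} (hST : Disjoint S T) {X : Ω → E} {Y : Ω → F}
    (hX : Measurable[⨆ i ∈ S, MeasurableSpace.comap (f i) inferInstance] X)
    (hY : Measurable[⨆ i ∈ T, MeasurableSpace.comap (f i) inferInstance] Y) :
    IndepFun X Y P := by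
  have h := indep_iSup_of_disjoint (fun i => (hf i).comap_le) hind hST
  exact indep_of_indep_of_le_left (indep_of_indep_of_le_right h hY.comap_le) hX.comap_le

lemma measurable_iSup_comap {Ω : Type*} (f : ι → Ω → ℂ) {S : Set ι} {i : ι} (hi : i ∈ S) :
    Measurable[⨆ i ∈ S, MeasurableSpace.comap (f i) inferInstance] (f i) :=
  Measurable.mono (comap_measurable (f i))
    (le_iSup₂_of_le (f := fun i (_ : i ∈ S) => MeasurableSpace.comap (f i) inferInstance)
      i hi le_rfl) le_rfl

/-- Conditioning on the first of two independent random variables. -/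
lemma lintegral_le_of_indepFun [IsProbabilityMeasure P] {X : Ω → E} {Y : Ω → F}
    (hX : Measurable X) (hY : Measurable Y) (hXY : IndepFun X Y P) {f : E → F → ℝ≥0∞}
    (hf : Measurable (Function.uncurry f)) {C : ℝ≥0∞}
    (h : ∀ ω, ∫⁻ ω', f (X ω) (Y ω') ∂P ≤ C) : ∫⁻ ω, f (X ω) (Y ω) ∂P ≤ C := by
  have : IsProbabilityMeasure (P.map Y) := Measure.isProbabilityMeasure_map hY.aemeasurable
  calc ∫⁻ ω, f (X ω) (Y ω) ∂P = ∫⁻ p, Function.uncurry f p ∂(P.map fun ω => (X ω, Y ω)) := by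
        rw [lintegral_map hf (hX.prodMk hY)]; rfl
    _ = ∫⁻ a, ∫⁻ b, Function.uncurry f (a, b) ∂(P.map Y) ∂(P.map X) := by
        rw [hXY.map_prod_eq_prod_map_map hX.aemeasurable hY.aemeasurable,
          lintegral_prod _ hf.aemeasurable]
    _ = ∫⁻ ω, ∫⁻ ω', f (X ω) (Y ω') ∂P ∂P := by
        rw [lintegral_map hf.lintegral_prod_right' hX]
        refine lintegral_congr fun ω => ?_
        exact lintegral_map (hf.comp measurable_prodMk_left) hY
    _ ≤ ∫⁻ _, C ∂P := lintegral_mono h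
    _ = C := by simp

end Independence

/-! ### Concentration of the channel gain for a fixed covariance matrix. -/

section Gain

open scoped ComplexOrder

variable {ι κ : Type*} [Fintype ι] [Fintype κ]

/-- The normalized power gain `tr (h q hᴴ) / (m tr q)` of a channel matrix `h` with `m` rows. -/
def gain (q : Matrix ι ι ℂ) (h : Matrix κ ι ℂ) : ℝ :=
  (h * q * h.conjTranspose).trace.re / (Fintype.card κ * q.trace.re)

/-- The i-th diagonal entry involves row i only, so the gain is an average of independent terms. -/
lemma trace_mul_mul_conjTranspose_re (q : Matrix ι ι ℂ) (h : Matrix κ ι ℂ) :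
    (h * q * h.conjTranspose).trace.re = ∑ i, quadForm q (h i) := by
  simp only [Matrix.trace, Complex.re_sum, Matrix.diag_apply, quadForm]
  refine Finset.sum_congr rfl fun i _ => ?_
  rw [Matrix.mul_assoc, Matrix.mul_apply]
  rfl

lemma measurable_gain :
    Measurable fun p : (ι → ι → ℂ) × (κ → ι → ℂ) => gain (Matrix.of p.1) (Matrix.of p.2) := by
  simp only [gain, Matrix.trace, Matrix.diag_apply, Matrix.mul_apply, Matrix.of_apply,
    Matrix.conjTranspose_apply]
  have hs : Measurable (star : ℂ → ℂ) := continuous_star.measurable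
  fun_prop

/-- An absolute constant in the fourth moment bound for `gain`. -/
def gainConst : ℝ := 3 * 3200001 ^ 2

variable {P : Measure Ω} [IsProbabilityMeasure P] {A : κ × ι → Ω → ℂ}

lemma lintegral_gain_sub_one_pow_four_le (hm : ∀ e, Measurable (A e))
    (hA : ∀ e, HasLaw (A e) stdComplexGaussian P) (hind : iIndepFun A P) [Nonempty κ]
    {q : Matrix ι ι ℂ} (hq : q.PosSemidef) (ht : 0 < q.trace.re) :
    ∫⁻ ω, ENNReal.ofReal ((gain q (Matrix.of fun i j => A (i, j) ω) - 1) ^ 4) ∂P ≤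
      ENNReal.ofReal (gainConst / (Fintype.card κ : ℝ) ^ 2) := by
  set u : κ → Ω → ℝ := fun i ω => quadForm q (fun j => A (i, j) ω) / q.trace.re with hu
  set Z : κ → Ω → ℝ := fun i ω => u i ω - 1 with hZ
  have hm0 : (0 : ℝ) < Fintype.card κ := by exact_mod_cast Fintype.card_pos
  have hrow : ∀ i, iIndepFun (fun j => A (i, j)) P := fun i =>
    hind.precomp (g := fun j => (i, j)) fun a b h => (Prod.mk.inj h).2
  have hu4 : ∀ i, MemLp (u i) 4 P := fun i => by
    have := (memLp_quadForm (fun j => hA (i, j)) q).mul_const (q.trace.re)⁻¹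
    simpa only [hu, div_eq_mul_inv] using this
  have hZ4 : ∀ i, MemLp (Z i) 4 P := fun i => (hu4 i).sub (memLp_const 1)
  have hmean : ∀ i, ∫ ω, Z i ω ∂P = 0 := fun i => by
    simp only [hZ]
    rw [integral_sub ((hu4 i).integrable (by norm_num)) (integrable_const _)]
    simp only [hu]
    rw [integral_div, integral_quadForm (fun j => hA (i, j)) (hrow i), div_self ht.ne']
    simp
  -- (u - 1)^4 ≤ u^4 + 1 for u ≥ 0, which adds 1 to the constant 3200000.
  have h4 : ∀ i, ∫ ω, Z i ω ^ 4 ∂P ≤ 3200001 := fun i => by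
    have i4 := integrable_pow_of_memLp_four (hu4 i) le_rfl
    calc ∫ ω, Z i ω ^ 4 ∂P ≤ ∫ ω, (u i ω ^ 4 + 1) ∂P := by
          refine integral_mono (integrable_pow_of_memLp_four (hZ4 i) le_rfl)
            (i4.add (integrable_const _)) fun ω => ?_
          have h0 : 0 ≤ u i ω := div_nonneg (quadForm_nonneg hq _) ht.le
          simp only [hZ]
          nlinarith [mul_nonneg h0 (sq_nonneg (u i ω - 1)), mul_nonneg h0 (sq_nonneg (u i ω))]
      _ = ∫ ω, u i ω ^ 4 ∂P + 1 := by
          rw [integral_add i4 (integrable_const _)]; simp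
      _ ≤ 3200001 := by
          linarith [integral_quadForm_div_trace_pow_four_le (fun j => hA (i, j)) (hrow i) hq ht]
  have hZm : ∀ (S : Set (κ × ι)) (i : κ), (∀ j, (i, j) ∈ S) →
      Measurable[⨆ e ∈ S, MeasurableSpace.comap (A e) inferInstance] (Z i) := by
    intro S i hS
    have hs : Measurable (star : ℂ → ℂ) := continuous_star.measurable
    have hφ : Measurable fun z : ι → ℂ => quadForm q z / q.trace.re - 1 := by
      simp only [quadForm, dotProduct, Matrix.mulVec, Pi.star_apply]
      fun_prop
    have : Measurable[⨆ e ∈ S, MeasurableSpace.comap (A e) inferInstance]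
        (fun ω (j : ι) => A (i, j) ω) := by
      exact @measurable_pi_lambda _ _ _ (_) _ _ fun j => measurable_iSup_comap A (hS j)
    exact hφ.comp this
  have hI : ∀ (s : Finset κ) (i : κ), i ∉ s → IndepFun (fun ω => ∑ j ∈ s, Z j ω) (Z i) P := by
    intro s i hi
    refine indepFun_of_measurable_iSup_comap hm hind (S := {e | e.1 ∈ s}) (T := {e | e.1 = i})
      ?_ ?_ (hZm _ i fun j => rfl)
    · rw [Set.disjoint_left]
      rintro e he rfl
      exact hi he
    · exact Finset.measurable_sum _ fun j hj => hZm _ j fun _ => hj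
  have hsum := integral_sum_pow_four_le (by norm_num) hZ4 hmean h4 hI Finset.univ
  have hSL : MemLp (fun ω => ∑ i, Z i ω) 4 P := memLp_finsetSum _ fun i _ => hZ4 i
  have hg : ∀ ω, (gain q (Matrix.of fun i j => A (i, j) ω) - 1) ^ 4 =
      (∑ i, Z i ω) ^ 4 * ((Fintype.card κ : ℝ) ^ 4)⁻¹ := by
    intro ω
    have : ∑ i, Z i ω = Fintype.card κ * (gain q (Matrix.of fun i j => A (i, j) ω) - 1) := by
      simp only [hZ, hu, gain, trace_mul_mul_conjTranspose_re, Finset.sum_sub_distrib,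
        ← Finset.sum_div]
      simp only [Finset.sum_const, Finset.card_univ, nsmul_eq_mul, mul_one]
      field_simp
      rfl
    rw [this]
    field_simp
  simp_rw [hg]
  rw [← ofReal_integral_eq_lintegral_ofReal
    ((integrable_pow_of_memLp_four hSL le_rfl).mul_const _)
    (ae_of_all _ fun ω => by
      have : 0 ≤ (∑ i, Z i ω) ^ 4 := Even.pow_nonneg (by decide) _
      positivity), integral_mul_const]
  refine ENNReal.ofReal_le_ofReal ?_
  rw [← div_eq_mul_inv, div_le_div_iff₀ (by positivity) (by positivity), gainConst]
  rw [Finset.card_univ] at hsum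
  calc _ ≤ 3 * 3200001 ^ 2 * (Fintype.card κ : ℝ) ^ 2 * (Fintype.card κ : ℝ) ^ 2 := by gcongr
    _ = _ := by ring

end Gain

/-! ### Covariance recursion for fixed channels. -/

section Covariance

open scoped ComplexOrder

/-- The covariance matrix of the vector that node `k` retransmits, for fixed channel matrices. -/
def cov (α ρ : ℕ → ℝ) (d : ℕ → ℕ) (h : ∀ k, Matrix (Fin (d (k + 1))) (Fin (d k)) ℂ) :
    ∀ k, Matrix (Fin (d k)) (Fin (d k)) ℂ
  | 0 => 1
  | k + 1 => ((α (k + 1) * ρ k / (cov α ρ d h k).trace.re : ℝ) : ℂ) •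
      (h k * cov α ρ d h k * (h k).conjTranspose) + 1

variable {α ρ : ℕ → ℝ} {d : ℕ → ℕ} {K : ℕ}

lemma trace_re_nonneg {n : ℕ} {q : Matrix (Fin n) (Fin n) ℂ} (hq : q.PosSemidef) :
    0 ≤ q.trace.re := (Complex.le_def.1 hq.trace_nonneg).1

lemma posSemidef_cov (hα : ∀ k, 1 ≤ k → k ≤ K → 0 ≤ α k) (hρ : ∀ k, k < K → 0 < ρ k)
    (h : ∀ k, Matrix (Fin (d (k + 1))) (Fin (d k)) ℂ) {k : ℕ} (hk : k ≤ K) :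
    (cov α ρ d h k).PosSemidef := by
  induction k with
  | zero => exact Matrix.PosSemidef.one
  | succ k ih =>
    have ih := ih (by omega)
    refine Matrix.PosSemidef.add (Matrix.PosSemidef.smul (ih.mul_mul_conjTranspose_same _) ?_)
      Matrix.PosSemidef.one
    rw [Complex.zero_le_real]
    exact div_nonneg (mul_nonneg (hα _ (by omega) hk) (hρ k (by omega)).le) (trace_re_nonneg ih)

lemma trace_cov_succ (h : ∀ k, Matrix (Fin (d (k + 1))) (Fin (d k)) ℂ) (k : ℕ) :
    (cov α ρ d h (k + 1)).trace.re = α (k + 1) * ρ k / (cov α ρ d h k).trace.re *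
      (h k * cov α ρ d h k * (h k).conjTranspose).trace.re + d (k + 1) := by
  simp [cov, Matrix.trace_add, Matrix.trace_smul]

lemma trace_cov_pos (hα : ∀ k, 1 ≤ k → k ≤ K → 0 ≤ α k) (hρ : ∀ k, k < K → 0 < ρ k)
    (h : ∀ k, Matrix (Fin (d (k + 1))) (Fin (d k)) ℂ) {k : ℕ} (hk : k ≤ K) (hd : 0 < d k) :
    0 < (cov α ρ d h k).trace.re := by
  cases k with
  | zero => simpa [cov] using hd
  | succ k =>
    have hq := posSemidef_cov (d := d) hα hρ h (k := k) (by omega)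
    rw [trace_cov_succ]
    have h1 := trace_re_nonneg (hq.mul_mul_conjTranspose_same (h k))
    have h2 : 0 ≤ α (k + 1) * ρ k / (cov α ρ d h k).trace.re :=
      div_nonneg (mul_nonneg (hα _ (by omega) hk) (hρ k (by omega)).le) (trace_re_nonneg hq)
    have : (0 : ℝ) < d (k + 1) := by exact_mod_cast hd
    positivity

variable {P : Measure Ω}

/-- Only uncorrelatedness of y and v is used, which is easier to carry along the nodes than
independence. -/
lemma secondMoment_mulVec_add {m n : ℕ} {y : Ω → Fin n → ℂ} {v : Ω → Fin m → ℂ}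
    (G : Matrix (Fin m) (Fin n) ℂ) (hy : ∀ a, MemLp (fun ω => y ω a) 2 P)
    (hv : ∀ i, MemLp (fun ω => v ω i) 2 P)
    (hyv : ∀ a i, ∫ ω, y ω a * star (v ω i) ∂P = 0) :
    secondMoment P (fun ω => G.mulVec (y ω) + v ω) =
      G * secondMoment P y * G.conjTranspose + secondMoment P v := by
  have hvy : ∀ a i, ∫ ω, v ω i * star (y ω a) ∂P = 0 := fun a i => by
    have h := integral_conj (μ := P) (f := fun ω => y ω a * star (v ω i))
    rw [hyv, map_zero] at h
    rw [← h]
    refine integral_congr_ae (ae_of_all _ fun ω => ?_)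
    simp [mul_comm]
  ext i j
  have e : ∀ ω, Matrix.vecMulVec (G.mulVec (y ω) + v ω) (star (G.mulVec (y ω) + v ω)) i j =
      (∑ b, ∑ a, G i a * star (G j b) * (y ω a * star (y ω b))) +
      (∑ a, G i a * (y ω a * star (v ω j))) + (∑ b, star (G j b) * (v ω i * star (y ω b))) +
      v ω i * star (v ω j) := by
    intro ω
    simp only [Matrix.vecMulVec_apply, Pi.add_apply, Pi.star_apply, star_add, Matrix.mulVec,
      dotProduct, star_sum, star_mul', add_mul, mul_add, Finset.sum_mul, Finset.mul_sum]
    have h1 : ∀ b a, G i a * y ω a * (star (G j b) * star (y ω b)) =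
      G i a * star (G j b) * (y ω a * star (y ω b)) := fun b a => by ring
    have h2 : ∀ a, G i a * y ω a * star (v ω j) = G i a * (y ω a * star (v ω j)) :=
      fun a => by ring
    have h3 : ∀ b, v ω i * (star (G j b) * star (y ω b)) =
      star (G j b) * (v ω i * star (y ω b)) := fun b => by ring
    simp only [h1, h2, h3, Finset.sum_add_distrib]
    ring
  have iyy : ∀ a b, Integrable (fun ω => G i a * star (G j b) * (y ω a * star (y ω b))) P :=
    fun a b => ((hy a).integrable_mul (hy b).star).const_mul _
  have iyv : ∀ a, Integrable (fun ω => G i a * (y ω a * star (v ω j))) P :=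
    fun a => ((hy a).integrable_mul (hv j).star).const_mul _
  have ivy : ∀ b, Integrable (fun ω => star (G j b) * (v ω i * star (y ω b))) P :=
    fun b => ((hv i).integrable_mul (hy b).star).const_mul _
  have ivv : Integrable (fun ω => v ω i * star (v ω j)) P :=
    (hv i).integrable_mul (hv j).star
  have I1 := integrable_finsetSum Finset.univ fun b _ =>
    integrable_finsetSum Finset.univ fun a _ => iyy a b
  have I2 := integrable_finsetSum Finset.univ fun a _ => iyv a
  have I3 := integrable_finsetSum Finset.univ fun b _ => ivy b
  simp only [secondMoment, Matrix.of_apply, Matrix.add_apply]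
  simp_rw [e]
  rw [integral_add (by exact (I1.add I2).add I3) ivv, integral_add (by exact I1.add I2) I3,
    integral_add I1 I2, integral_finsetSum _ fun a _ => iyv a,
    integral_finsetSum _ fun b _ => ivy b,
    integral_finsetSum _ fun b _ => integrable_finsetSum _ fun a _ => iyy a b]
  simp only [integral_const_mul, hyv, hvy, mul_zero, Finset.sum_const_zero, add_zero]
  congr 1
  rw [Matrix.mul_apply]
  refine Finset.sum_congr rfl fun b _ => ?_
  rw [integral_finsetSum _ fun a _ => iyy a b, Matrix.mul_apply, Finset.sum_mul]
  refine Finset.sum_congr rfl fun a _ => ?_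
  rw [integral_const_mul, Matrix.conjTranspose_apply]
  simp only [Matrix.of_apply, Matrix.vecMulVec_apply, Pi.star_apply]
  ring

lemma secondMoment_eq_one [IsFiniteMeasure P] {m : ℕ} {v : Ω → Fin m → ℂ}
    (hv : ∀ i, HasLaw (fun ω => v ω i) stdComplexGaussian P)
    (hind : ∀ i j, i ≠ j → IndepFun (fun ω => v ω i) (fun ω => v ω j) P) :
    secondMoment P v = 1 := by
  ext i j
  simp only [secondMoment, Matrix.of_apply, Matrix.vecMulVec_apply, Pi.star_apply]
  rcases eq_or_ne i j with rfl | h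
  · rw [integral_mul_star_self_of_hasLaw (hv i), Matrix.one_apply_eq]
  · rw [integral_mul_star_of_indepFun (hv i) (hv j) (hind i j h), Matrix.one_apply_ne h]

variable {H : ∀ k, Ω → Matrix (Fin (d (k + 1))) (Fin (d k)) ℂ}
  {x : Ω → Fin (d 0) → ℂ} {w : ∀ k, Ω → Fin (d (k + 1)) → ℂ}

lemma node_snd (h : ∀ k, Matrix (Fin (d (k + 1))) (Fin (d k)) ℂ) (k : ℕ) :
    (node P α ρ d h x w k).2 = powerFactor P (ρ k) (node P α ρ d h x w k).1 := by
  cases k <;> rfl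

/-- Collects the scalars into the matrix, as `secondMoment_mulVec_add` requires. -/
lemma node_succ_fst (h : ∀ k, Matrix (Fin (d (k + 1))) (Fin (d k)) ℂ) (k : ℕ) :
    (node P α ρ d h x w (k + 1)).1 = fun ω =>
      (((√(α (k + 1)) * √((node P α ρ d h x w k).2 / d k) : ℝ) : ℂ) • h k).mulVec
        ((node P α ρ d h x w k).1 ω) + w k ω := by
  funext ω
  simp only [node]
  rw [Matrix.mulVec_smul, smul_smul, ← Matrix.smul_mulVec]
  push_cast
  rfl

/-- For fixed channel matrices, the second moment matrices of the node vectors are `cov`. -/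
lemma secondMoment_node [IsProbabilityMeasure P] (hmodel : IsGaussianModel P K d H x w)
    (hα : ∀ k, 1 ≤ k → k ≤ K → 0 ≤ α k) (hρ : ∀ k, k < K → 0 < ρ k)
    (h : ∀ k, Matrix (Fin (d (k + 1))) (Fin (d k)) ℂ) {k : ℕ} (hk : k ≤ K) :
    secondMoment P (node P α ρ d h x w k).1 = cov α ρ d h k := by
  have hxl : ∀ i, HasLaw (fun ω => x ω i) stdComplexGaussian P := fun i =>
    hmodel.law (.inr (.inl i))
  have hwl : ∀ l, l < K → ∀ i, HasLaw (fun ω => w l ω i) stdComplexGaussian P := fun l hl i =>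
    hmodel.law (.inr (.inr ⟨⟨l, hl⟩, i⟩))
  have hxw : ∀ l, l < K → ∀ i j, IndepFun (fun ω => x ω i) (fun ω => w l ω j) P :=
    fun l hl i j => hmodel.indep.indepFun (i := .inr (.inl i)) (j := .inr (.inr ⟨⟨l, hl⟩, j⟩))
      (by simp)
  have hww : ∀ l l' (hl : l < K) (hl' : l' < K), ∀ i j,
      (⟨⟨l, hl⟩, i⟩ : Σ k : Fin K, Fin (d (k + 1))) ≠ ⟨⟨l', hl'⟩, j⟩ →
      IndepFun (fun ω => w l ω i) (fun ω => w l' ω j) P := fun l l' hl hl' i j hne =>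
    hmodel.indep.indepFun (i := .inr (.inr ⟨⟨l, hl⟩, i⟩)) (j := .inr (.inr ⟨⟨l', hl'⟩, j⟩))
      fun h => hne (Sum.inr.inj (Sum.inr.inj h))
  -- The induction also carries square integrability and uncorrelatedness with all noise still to
  -- come; `w l` enters at node l + 1, hence k ≤ l.
  suffices hs : (∀ i, MemLp (fun ω => (node P α ρ d h x w k).1 ω i) 2 P) ∧
      (∀ l, k ≤ l → l < K → ∀ i j,
        ∫ ω, (node P α ρ d h x w k).1 ω i * star (w l ω j) ∂P = 0) ∧
      secondMoment P (node P α ρ d h x w k).1 = cov α ρ d h k from hs.2.2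
  induction k with
  | zero =>
    refine ⟨fun i => memLp_of_hasLaw (hxl i) 2, fun l _ hl i j =>
      integral_mul_star_of_indepFun (hxl i) (hwl l hl j) (hxw l hl i j), ?_⟩
    exact secondMoment_eq_one hxl fun i j hij =>
      hmodel.indep.indepFun (i := .inr (.inl i)) (j := .inr (.inl j)) (by simpa using hij)
  | succ k ih =>
    obtain ⟨ih1, ih2, ih3⟩ := ih (by omega)
    have hkK : k < K := by omega
    rw [node_succ_fst]
    set c : ℝ := √(α (k + 1)) * √((node P α ρ d h x w k).2 / d k) with hc
    have hw2 : ∀ l, l < K → ∀ i, MemLp (fun ω => w l ω i) 2 P := fun l hl i =>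
      memLp_of_hasLaw (hwl l hl i) 2
    refine ⟨fun i => ?_, fun l hl hlK i j => ?_, ?_⟩
    · have : MemLp (fun ω => ∑ a, ((c : ℂ) • h k) i a * (node P α ρ d h x w k).1 ω a) 2 P :=
        memLp_finsetSum _ fun a _ => (ih1 a).const_mul _
      exact this.add (hw2 k hkK i)
    · have e : ∀ ω, ((((c : ℂ) • h k).mulVec ((node P α ρ d h x w k).1 ω) + w k ω) i) *
          star (w l ω j) = (∑ a, ((c : ℂ) • h k) i a *
            ((node P α ρ d h x w k).1 ω a * star (w l ω j))) + w k ω i * star (w l ω j) := by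
        intro ω
        simp only [Pi.add_apply, Matrix.mulVec, dotProduct, add_mul, Finset.sum_mul, mul_assoc]
      have i1 : ∀ a, Integrable (fun ω => ((c : ℂ) • h k) i a *
          ((node P α ρ d h x w k).1 ω a * star (w l ω j))) P := fun a =>
        ((ih1 a).integrable_mul (hw2 l hlK j).star).const_mul _
      have i2 : Integrable (fun ω => w k ω i * star (w l ω j)) P :=
        (hw2 k hkK i).integrable_mul (hw2 l hlK j).star
      simp_rw [e]
      rw [integral_add (integrable_finsetSum _ fun a _ => i1 a) i2,
        integral_finsetSum _ fun a _ => i1 a]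
      simp only [integral_const_mul, ih2 l (by omega) hlK, mul_zero, Finset.sum_const_zero,
        zero_add]
      refine integral_mul_star_of_indepFun (hwl k hkK i) (hwl l hlK j) (hww k l hkK hlK i j ?_)
      intro hh
      have := congrArg (fun s : (Σ k : Fin K, Fin (d (k + 1))) => (s.1 : ℕ)) hh
      simp only at this
      omega
    · rw [secondMoment_mulVec_add _ ih1 (hw2 k hkK) (ih2 k le_rfl hkK), ih3,
        secondMoment_eq_one (hwl k hkK) fun i j hij => hww k k hkK hkK i j (by simpa using hij),
        cov]
      congr 1
      have hq := posSemidef_cov (d := d) hα hρ h (k := k) (by omega)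
      have hβ : (node P α ρ d h x w k).2 / d k = ρ k / (cov α ρ d h k).trace.re := by
        rw [node_snd, powerFactor, ih3]
        -- For an empty node both sides are quotients by zero, hence 0.
        rcases Nat.eq_zero_or_pos (d k) with h0 | h0
        · have : IsEmpty (Fin (d k)) := by rw [h0]; infer_instance
          simp [h0, Matrix.trace]
        · have : (d k : ℝ) ≠ 0 := by exact_mod_cast h0.ne'
          have := (trace_cov_pos hα hρ h (k := k) (by omega) h0).ne'
          field_simp
      have hcc : c * c = α (k + 1) * ρ k / (cov α ρ d h k).trace.re := by
        rw [hc, hβ, mul_mul_mul_comm, Real.mul_self_sqrt (hα _ (by omega) hk),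
          Real.mul_self_sqrt (div_nonneg (hρ k hkK).le (trace_re_nonneg hq)), mul_div_assoc]
      rw [← hcc, Matrix.conjTranspose_smul, Matrix.smul_mul, Matrix.smul_mul, Matrix.mul_smul,
        smul_smul]
      simp

/-- The normalization factors in terms of the channel gains. -/
lemma node_succ_snd [IsProbabilityMeasure P] (hmodel : IsGaussianModel P K d H x w)
    (hα : ∀ k, 1 ≤ k → k ≤ K → 0 ≤ α k) (hρ : ∀ k, k < K → 0 < ρ k)
    (h : ∀ k, Matrix (Fin (d (k + 1))) (Fin (d k)) ℂ) {k : ℕ} (hk : k < K)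
    (hd : 0 < d (k + 1)) :
    (node P α ρ d h x w (k + 1)).2 =
      ρ (k + 1) / (1 + α (k + 1) * ρ k * gain (cov α ρ d h k) (h k)) := by
  rw [node_snd, powerFactor, secondMoment_node hmodel hα hρ h (by omega), trace_cov_succ, gain,
    Fintype.card_fin]
  congr 1
  have : (d (k + 1) : ℝ) ≠ 0 := by exact_mod_cast hd.ne'
  rw [mul_add, one_div, inv_mul_cancel₀ this, add_comm]
  congr 1
  rw [div_eq_mul_inv, div_eq_mul_inv, mul_inv]
  ring

end Covariance

/-! ### Almost sure convergence from summable moments; growth of the dimensions. -/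

section Convergence

variable {P : Measure Ω}

/-- The sum of the (R n - a)^4 has finite expectation, so it is almost surely finite and its terms
tend to 0. Nothing links different n. -/
lemma tendsto_of_eventually_lintegral_pow_four_le {R : ℕ → Ω → ℝ} {a C : ℝ}
    (hm : ∀ᶠ n in atTop, AEMeasurable (R n) P)
    (hR : ∀ᶠ n : ℕ in atTop,
      ∫⁻ ω, ENNReal.ofReal ((R n ω - a) ^ 4) ∂P ≤ ENNReal.ofReal (C / (n : ℝ) ^ 2)) :
    ∀ᵐ ω ∂P, Tendsto (fun n => R n ω) atTop (𝓝 a) := by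
  obtain ⟨N, hN⟩ := eventually_atTop.1 (hm.and hR)
  set g : ℕ → Ω → ℝ≥0∞ := fun n ω => ENNReal.ofReal ((R (n + N) ω - a) ^ 4) with hg
  have hgm : ∀ n, AEMeasurable (g n) P := fun n =>
    (((hN (n + N) (by omega)).1.sub_const a).pow_const 4).ennreal_ofReal
  have hsum : Summable fun n : ℕ => C / ((n + N : ℕ) : ℝ) ^ 2 := by
    have h : Summable fun n : ℕ => C / (n : ℝ) ^ 2 := by
      simpa [div_eq_mul_inv] using
        (Real.summable_nat_pow_inv.2 (by norm_num : 1 < 2)).mul_left C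
    exact (summable_nat_add_iff N).2 h
  have hfin : ∫⁻ ω, ∑' n, g n ω ∂P ≠ ⊤ := by
    rw [lintegral_tsum hgm]
    exact ne_top_of_le_ne_top hsum.tsum_ofReal_ne_top
      (ENNReal.tsum_le_tsum fun n => (hN (n + N) (by omega)).2)
  filter_upwards [ae_lt_top' (AEMeasurable.tsum hgm) hfin] with ω hω
  have h0 := ENNReal.tendsto_atTop_zero_of_tsum_ne_top hω.ne
  have h1 : Tendsto (fun n => (R (n + N) ω - a) ^ 4) atTop (𝓝 0) := by
    have := (ENNReal.tendsto_toReal ENNReal.zero_ne_top).comp h0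
    refine Tendsto.congr (fun n => ?_) this
    exact ENNReal.toReal_ofReal (Even.pow_nonneg (by decide) _)
  have h2 : Tendsto (fun n => |R (n + N) ω - a|) atTop (𝓝 0) := by
    have h := (h1.sqrt).sqrt
    simp only [Real.sqrt_zero] at h
    refine h.congr fun n => ?_
    rw [show (R (n + N) ω - a) ^ 4 = ((R (n + N) ω - a) ^ 2) ^ 2 by ring,
      Real.sqrt_sq (sq_nonneg _), Real.sqrt_sq_eq_abs]
  have h3 := (tendsto_zero_iff_abs_tendsto_zero _).2 h2
  rw [← tendsto_add_atTop_iff_nat N]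
  simpa using h3.add_const a

/-- The node dimensions grow at least linearly with the dimension of the source. -/
lemma eventually_mul_le_dim {K : ℕ} {d : ℕ → ℕ → ℕ} (hd : ∀ n, d n 0 = n)
    (hc : ∀ k, 1 ≤ k → k ≤ K →
      limsup (fun n => (d n (k - 1) : ℝ≥0∞) / (d n k : ℝ≥0∞)) atTop < ⊤)
    {k : ℕ} (hk : k ≤ K) :
    ∃ c : ℝ, 0 < c ∧ ∀ᶠ n : ℕ in atTop, c * n ≤ d n k := by
  induction k with
  | zero => exact ⟨1, one_pos, Eventually.of_forall fun n => by simp [hd]⟩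
  | succ k ih =>
    obtain ⟨c, hc0, hcn⟩ := ih (by omega)
    have h := hc (k + 1) (by omega) hk
    simp only [Nat.add_sub_cancel] at h
    obtain ⟨M, hM, -⟩ := ENNReal.lt_iff_exists_nnreal_btwn.1 h
    refine ⟨c / (M + 1), by positivity, ?_⟩
    filter_upwards [hcn, eventually_lt_of_limsup_lt hM] with n h1 h2
    have h3 : (d n k : ℝ) ≤ M * d n (k + 1) := by
      -- A nonzero dimension over 0 is ⊤ in `ℝ≥0∞`, which the bound by M excludes; so eventual
      -- positivity of the dimensions comes from the limsup condition.
      rcases Nat.eq_zero_or_pos (d n (k + 1)) with h0 | h0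
      · rcases Nat.eq_zero_or_pos (d n k) with h4 | h4
        · simp [h4, h0]
        · rw [h0, Nat.cast_zero, ENNReal.div_zero (by exact_mod_cast h4.ne')] at h2
          simp at h2
      · rw [ENNReal.div_lt_iff (Or.inl (by exact_mod_cast h0.ne')) (Or.inl (by simp))] at h2
        have h5 : (d n k : ℝ≥0) < M * d n (k + 1) := by exact_mod_cast h2
        exact_mod_cast h5.le
    rw [div_mul_eq_mul_div, div_le_iff₀ (by positivity)]
    have : (0 : ℝ) ≤ d n (k + 1) := by positivity
    nlinarith

end Convergence

/-! ### Concentration of the gain with its random covariance matrix. -/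

section Channel

variable {α ρ : ℕ → ℝ} {d : ℕ → ℕ} {K : ℕ}

/-- Also applied with the σ-algebra generated by the entries of the first k matrices in place of the
ambient one. -/
lemma measurable_cov {H : ∀ k, Ω → Matrix (Fin (d (k + 1))) (Fin (d k)) ℂ} {k : ℕ}
    (hH : ∀ j, j < k → ∀ a b, Measurable fun ω => H j ω a b) (a b : Fin (d k)) :
    Measurable fun ω => cov α ρ d (fun j => H j ω) k a b := by
  induction k with
  | zero => exact measurable_const
  | succ k ih =>
    have ih := ih fun j hj => hH j (by omega)
    have hk := hH k (by omega)
    have hs : Measurable (star : ℂ → ℂ) := continuous_star.measurable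
    simp only [cov, Matrix.add_apply, Matrix.smul_apply, Matrix.mul_apply, Matrix.trace,
      Matrix.diag_apply, Matrix.conjTranspose_apply, smul_eq_mul]
    fun_prop

variable {P : Measure Ω} [IsProbabilityMeasure P]
  {H : ∀ k, Ω → Matrix (Fin (d (k + 1))) (Fin (d k)) ℂ}
  {x : Ω → Fin (d 0) → ℂ} {w : ∀ k, Ω → Fin (d (k + 1)) → ℂ}

/-- Fourth moment bound for the deviation of the channel gain of a hop from its mean. -/
lemma lintegral_gain_cov_le (hmodel : IsGaussianModel P K d H x w)
    (hα : ∀ k, 1 ≤ k → k ≤ K → 0 ≤ α k) (hρ : ∀ k, k < K → 0 < ρ k) {k : ℕ} (hk : k < K)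
    (hd : 0 < d k) (hd' : 0 < d (k + 1)) :
    AEMeasurable (fun ω => gain (cov α ρ d (fun j => H j ω) k) (H k ω)) P ∧
    ∫⁻ ω, ENNReal.ofReal ((gain (cov α ρ d (fun j => H j ω) k) (H k ω) - 1) ^ 4) ∂P ≤
      ENNReal.ofReal (gainConst / (d (k + 1) : ℝ) ^ 2) := by
  classical
  -- `HasLaw` gives only a.e. measurability; the generated σ-algebras need measurable versions.
  set E : EntryIndex K d → Ω → ℂ := fun e => (hmodel.law e).aemeasurable.mk _ with hE
  have hEm : ∀ e, Measurable (E e) := fun e => (hmodel.law e).aemeasurable.measurable_mk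
  have hEe : ∀ e, entry K d H x w e =ᵐ[P] E e := fun e => (hmodel.law e).aemeasurable.ae_eq_mk
  have hEl : ∀ e, HasLaw (E e) stdComplexGaussian P := fun e =>
    (hmodel.law e).congr (hEe e).symm
  have hEi : iIndepFun E P := hmodel.indep.congr hEe
  let H' : ∀ k, Ω → Matrix (Fin (d (k + 1))) (Fin (d k)) ℂ := fun j ω =>
    if hj : j < K then Matrix.of fun a b => E (.inl ⟨⟨j, hj⟩, a, b⟩) ω else H j ω
  have hH' : ∀ j (hj : j < K) ω a b, H' j ω a b = E (.inl ⟨⟨j, hj⟩, a, b⟩) ω := by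
    intro j hj ω a b
    simp [H', hj]
  have hHe : ∀ᵐ ω ∂P, ∀ j, H' j ω = H j ω := by
    filter_upwards [ae_all_iff.2 hEe] with ω hω j
    by_cases hj : j < K
    · ext a b
      rw [hH' j hj, ← hω]
      rfl
    · simp [H', hj]
  -- S holds the entries that determine the covariance at node k, T those of the next channel.
  let S : Set (EntryIndex K d) := {e | ∃ j : Fin K, (j : ℕ) < k ∧ ∃ ab, e = .inl ⟨j, ab⟩}
  let T : Set (EntryIndex K d) := {e | ∃ ab, e = .inl ⟨⟨k, hk⟩, ab⟩}
  have hST : Disjoint S T := by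
    rw [Set.disjoint_left]
    rintro e ⟨j, hj, ab, rfl⟩ ⟨ab', he⟩
    have := congrArg (fun s : (Σ k : Fin K, Fin (d (k + 1)) × Fin (d k)) => (s.1 : ℕ))
      (Sum.inl.inj he)
    simp only at this
    omega
  let X : Ω → Fin (d k) → Fin (d k) → ℂ := fun ω a b => cov α ρ d (fun j => H' j ω) k a b
  let Y : Ω → Fin (d (k + 1)) → Fin (d k) → ℂ := fun ω a b => H' k ω a b
  have hXS : Measurable[⨆ e ∈ S, MeasurableSpace.comap (E e) inferInstance] X := by
    refine @measurable_pi_lambda _ _ _ (_) _ _ fun a => @measurable_pi_lambda _ _ _ (_) _ _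
      fun b => @measurable_cov Ω (_) α ρ d H' k (fun j hj a b => ?_) a b
    simp only [hH' j (hj.trans hk)]
    exact measurable_iSup_comap E ⟨⟨j, hj.trans hk⟩, hj, (a, b), rfl⟩
  have hYT : Measurable[⨆ e ∈ T, MeasurableSpace.comap (E e) inferInstance] Y := by
    refine @measurable_pi_lambda _ _ _ (_) _ _ fun a => @measurable_pi_lambda _ _ _ (_) _ _
      fun b => ?_
    simp only [Y, hH' k hk]
    exact measurable_iSup_comap E ⟨(a, b), rfl⟩
  have hle : ∀ S : Set (EntryIndex K d),
      ⨆ e ∈ S, MeasurableSpace.comap (E e) inferInstance ≤ ‹MeasurableSpace Ω› := fun S =>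
    iSup₂_le fun e _ => (hEm e).comap_le
  have hX : Measurable X := hXS.mono (hle S) le_rfl
  have hY : Measurable Y := hYT.mono (hle T) le_rfl
  have hind : IndepFun X Y P := indepFun_of_measurable_iSup_comap hEm hEi hST hXS hYT
  have hgain : ∀ᵐ ω ∂P, gain (Matrix.of (X ω)) (Matrix.of (Y ω)) =
      gain (cov α ρ d (fun j => H j ω) k) (H k ω) := by
    filter_upwards [hHe] with ω hω
    have h1 : (fun j => H' j ω) = fun j => H j ω := funext hω
    have hXω : Matrix.of (X ω) = cov α ρ d (fun j => H j ω) k := by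
      rw [← h1]; rfl
    have hYω : Matrix.of (Y ω) = H k ω := by
      rw [← hω k]; rfl
    rw [hXω, hYω]
  refine ⟨((measurable_gain.comp (hX.prodMk hY)).aemeasurable).congr hgain, ?_⟩
  have hne : Nonempty (Fin (d (k + 1))) := ⟨⟨0, hd'⟩⟩
  let φ : Fin (d (k + 1)) × Fin (d k) → EntryIndex K d := fun ab => .inl ⟨⟨k, hk⟩, ab⟩
  have hφ : Function.Injective φ := fun a b hab => by simpa [φ] using hab
  have hEφ : iIndepFun (fun ab => E (φ ab)) P := hEi.precomp hφ
  calc _ = ∫⁻ ω, ENNReal.ofReal ((gain (Matrix.of (X ω)) (Matrix.of (Y ω)) - 1) ^ 4) ∂P :=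
        lintegral_congr_ae (hgain.mono fun ω hω => by simp only [hω])
    _ ≤ _ := by
        -- Freezing X leaves a deterministic positive semidefinite matrix of positive trace, and the
        -- bound does not depend on it.
        refine lintegral_le_of_indepFun hX hY hind
          (f := fun a b => ENNReal.ofReal ((gain (Matrix.of a) (Matrix.of b) - 1) ^ 4))
          ((measurable_gain.sub_const 1).pow_const 4).ennreal_ofReal fun ω => ?_
        have h := lintegral_gain_sub_one_pow_four_le (P := P)
          (A := fun ab => E (φ ab)) (fun ab => hEm _) (fun ab => hEl _) hEφ
          (posSemidef_cov hα hρ (fun j => H' j ω) hk.le)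
          (trace_cov_pos hα hρ (fun j => H' j ω) hk.le hd)
        rw [Fintype.card_fin] at h
        simp only [Y, hH' k hk]
        exact h

end Channel

end Relay

end

theorem lemma1 {Ω : Type*} [MeasurableSpace Ω] (P : Measure Ω) [IsProbabilityMeasure P]
    (K : ℕ) (α ρ : ℕ → ℝ)
    (hα : ∀ k, 1 ≤ k → k ≤ K → 0 ≤ α k) (hρ : ∀ k, k < K → 0 < ρ k)
    -- `d n k` is the number of antennas of node `k` when the source has `n` antennas
    (d : ℕ → ℕ → ℕ) (hd : ∀ n, d n 0 = n)
    (hc : ∀ k, 1 ≤ k → k ≤ K →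
      0 < liminf (fun n => (d n (k - 1) : ℝ≥0∞) / (d n k : ℝ≥0∞)) atTop ∧
      limsup (fun n => (d n (k - 1) : ℝ≥0∞) / (d n k : ℝ≥0∞)) atTop < ⊤)
    (H : ∀ n k, Ω → Matrix (Fin (d n (k + 1))) (Fin (d n k)) ℂ)
    (x : ∀ n, Ω → Fin (d n 0) → ℂ) (w : ∀ n k, Ω → Fin (d n (k + 1)) → ℂ)
    -- for each `n`; nothing is assumed on the joint law for different `n`
    (hmodel : ∀ n, Relay.IsGaussianModel P K (d n) (H n) (x n) (w n)) :
    (∀ n, 1 ≤ n → ∀ ω, Relay.beta P α ρ (d n) (H n) (x n) (w n) 0 ω = ρ 0) ∧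
    ∀ k, 1 ≤ k → k < K → ∀ᵐ ω ∂P,
      Tendsto (fun n => Relay.beta P α ρ (d n) (H n) (x n) (w n) k ω) atTop
        (𝓝 (ρ k / (1 + α k * ρ (k - 1)))) := by
  refine ⟨fun n hn ω => ?_, fun k hk1 hkK => ?_⟩
  · rw [Relay.beta, Relay.node_snd, Relay.powerFactor,
      Relay.secondMoment_node (hmodel n) hα hρ _ (Nat.zero_le K), Relay.cov]
    have h0 : (d n 0 : ℝ) ≠ 0 := by rw [hd]; exact_mod_cast (by omega : n ≠ 0)
    simp [h0]
  · obtain ⟨k, rfl⟩ : ∃ j, k = j + 1 := ⟨k - 1, by omega⟩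
    have hpos : ∀ j, j ≤ K → ∀ᶠ n in atTop, 0 < d n j := fun j hj => by
      obtain ⟨c, hc0, hcn⟩ := Relay.eventually_mul_le_dim hd (fun k h1 h2 => (hc k h1 h2).2) hj
      filter_upwards [hcn, eventually_ge_atTop 1] with n h1 h2
      have : (0 : ℝ) < d n j := lt_of_lt_of_le (mul_pos hc0 (by exact_mod_cast h2)) h1
      exact_mod_cast this
    obtain ⟨c, hc0, hcn⟩ :=
      Relay.eventually_mul_le_dim hd (fun k h1 h2 => (hc k h1 h2).2) hkK.le
    have hgain : ∀ᵐ ω ∂P, Tendsto (fun n =>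
        Relay.gain (Relay.cov α ρ (d n) (fun j => H n j ω) k) (H n k ω)) atTop (𝓝 1) := by
      -- c n ≤ n_{k+1} turns gainConst / n_{k+1}² into (gainConst / c²) / n².
      refine Relay.tendsto_of_eventually_lintegral_pow_four_le (C := Relay.gainConst / c ^ 2) ?_ ?_
      · filter_upwards [hpos k (by omega), hpos (k + 1) (by omega)] with n h1 h2
        exact (Relay.lintegral_gain_cov_le (hmodel n) hα hρ (by omega) h1 h2).1
      · filter_upwards [hpos k (by omega), hpos (k + 1) (by omega), hcn, eventually_ge_atTop 1]
          with n h1 h2 h3 h4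
        refine (Relay.lintegral_gain_cov_le (hmodel n) hα hρ (by omega) h1 h2).2.trans
          (ENNReal.ofReal_le_ofReal ?_)
        have hn : (0 : ℝ) < n := by exact_mod_cast h4
        rw [div_div, ← mul_pow]
        have : 0 ≤ Relay.gainConst := by norm_num [Relay.gainConst]
        gcongr
    filter_upwards [hgain] with ω hω
    have h1 : 0 < 1 + α (k + 1) * ρ k * 1 := by
      have := mul_nonneg (hα (k + 1) hk1 hkK.le) (hρ k (by omega)).le
      linarith
    have h2 := Tendsto.div (tendsto_const_nhds (x := ρ (k + 1)))
      ((hω.const_mul (α (k + 1) * ρ k)).const_add 1) h1.ne'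
    rw [mul_one] at h2
    refine h2.congr' ?_
    filter_upwards [hpos (k + 1) hkK.le] with n hn
    exact (Relay.node_succ_snd (hmodel n) hα hρ _ (by omega) hn).symm
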